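/- Let $\hbar>0$ and let $\mu$ be a Borel probability measure on $\mathbb{R}$ (the law of a random momentum kick; $d\mu(p)=\tilde g(p)\,dp$ when it has a density $\tilde g$). Let $\hat X$ be the position operator on $L^2(\mathbb{R})$ (complex-valued functions), so that $e^{\frac{i}{\hbar}p\hat X}$ is multiplication by $x\mapsto e^{\frac{i}{\hbar}px}$. For a bounded operator $\rho$ on $L^2(\mathbb{R})$ define the random-momentum-kick dephasing channel $$\Delta_g(\rho)=\int_{\mathbb{R}} e^{\frac{i}{\hbar}p\hat X}\,\rho\,e^{-\frac{i}{\hbar}p\hat X}\,d\mu(p)$$ (integral in the strong operator topology), and let $$g(\xi)=\int_{\mathbb{R}} e^{\frac{i}{\hbar}p\xi}\,d\mu(p)$$ be the characteristic function of the kick. (On square-integrable position kernels $\Delta_g$ thus acts by $\rho(x,y)\mapsto g(x-y)\rho(x,y)$.) Suppose that $|g(\xi)|<1$ for every $\xi\neq 0$. Then the set $\mathcal{I}^g_{\mathrm{fix}}$ of positive bounded operators $\rho$ on $L^2(\mathbb{R})$ with $\Delta_g(\rho)=\rho$ contains no normal density operator, i.e. no trace-class operator with trace $1$; equivalently, no positive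 trace-class operator $\rho$ on $L^2(\mathbb{R})$ with $\operatorname{Tr}\rho=1$ satisfies $\Delta_g(\rho)=\rho$. -/

import Mathlib

open MeasureTheory Filter Topology
open scoped ComplexConjugate

noncomputable section

namespace PositionDephasing

/-- The Hilbert space `L²(ℝ)` of square-integrable complex wave functions. -/
abbrev WaveSpace : Type := Lp ℂ 2 (volume : Measure ℝ)

/-- The phase `e^{(i/ħ) p x}`. -/
def phase (hbar p x : ℝ) : ℂ := Complex.exp (Complex.I * ((p * x / hbar : ℝ) : ℂ))

theorem norm_phase (hbar p x : ℝ) : ‖phase hbar p x‖ = 1 := by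
  rw [phase, mul_comm]; exact Complex.norm_exp_ofReal_mul_I _

theorem continuous_phase (hbar : ℝ) : Continuous fun z : ℝ × ℝ => phase hbar z.1 z.2 := by
  unfold phase; fun_prop

theorem continuous_phase_left (hbar x : ℝ) : Continuous fun p => phase hbar p x := by
  unfold phase; fun_prop

theorem continuous_phase_right (hbar p : ℝ) : Continuous fun x => phase hbar p x := by
  unfold phase; fun_prop

theorem memLp_phase_mul (hbar p : ℝ) (ψ : WaveSpace) :
    MemLp (fun x => phase hbar p x * ψ x) 2 volume := by
  refine (Lp.memLp ψ).of_le
    ((continuous_phase_right hbar p).aestronglyMeasurable.mul (Lp.aestronglyMeasurable ψ)) ?_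
  filter_upwards with x
  rw [norm_mul, norm_phase, one_mul]

/-- The momentum kick `e^{(i/ħ) p X}`: multiplication by `x ↦ e^{(i/ħ) p x}` on `L²(ℝ)`. -/
def kick (hbar p : ℝ) : WaveSpace →L[ℂ] WaveSpace :=
  LinearMap.mkContinuous
    { toFun := fun ψ => (memLp_phase_mul hbar p ψ).toLp _
      map_add' := fun φ ψ => by
        apply Lp.ext
        filter_upwards [MemLp.coeFn_toLp (memLp_phase_mul hbar p (φ + ψ)),
          MemLp.coeFn_toLp (memLp_phase_mul hbar p φ), MemLp.coeFn_toLp (memLp_phase_mul hbar p ψ),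
          Lp.coeFn_add φ ψ, Lp.coeFn_add ((memLp_phase_mul hbar p φ).toLp _)
            ((memLp_phase_mul hbar p ψ).toLp _)] with x h1 h2 h3 h4 h5
        simp only [h1, h2, h3, h4, h5, Pi.add_apply, mul_add]
      map_smul' := fun c ψ => by
        apply Lp.ext
        filter_upwards [MemLp.coeFn_toLp (memLp_phase_mul hbar p (c • ψ)),
          MemLp.coeFn_toLp (memLp_phase_mul hbar p ψ),
          Lp.coeFn_smul c ψ, Lp.coeFn_smul c ((memLp_phase_mul hbar p ψ).toLp _)] with x h1 h2 h3 h4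
        simp only [h1, h2, h3, h4, Pi.smul_apply, smul_eq_mul, RingHom.id_apply]
        ring }
    1 (fun ψ => by
      rw [one_mul]
      refine Lp.norm_le_norm_of_ae_le ?_
      filter_upwards [MemLp.coeFn_toLp (memLp_phase_mul hbar p ψ)] with x h1
      change ‖((memLp_phase_mul hbar p ψ).toLp _ : WaveSpace) x‖ ≤ _
      rw [h1, norm_mul, norm_phase, one_mul])

theorem coeFn_kick (hbar p : ℝ) (ψ : WaveSpace) :
    kick hbar p ψ =ᵐ[volume] fun x => phase hbar p x * ψ x :=
  MemLp.coeFn_toLp (memLp_phase_mul hbar p ψ)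

theorem norm_kick_apply (hbar p : ℝ) (ψ : WaveSpace) : ‖kick hbar p ψ‖ = ‖ψ‖ := by
  refine le_antisymm (Lp.norm_le_norm_of_ae_le ?_) (Lp.norm_le_norm_of_ae_le ?_) <;>
  · filter_upwards [coeFn_kick hbar p ψ] with x h1
    rw [h1, norm_mul, norm_phase, one_mul]

theorem continuous_inner_kick (hbar : ℝ) (φ ψ : WaveSpace) :
    Continuous fun p => inner ℂ φ (kick hbar p ψ) := by
  have h : ∀ p, inner ℂ φ (kick hbar p ψ) = ∫ x, phase hbar p x * inner ℂ (φ x) (ψ x) := by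
    intro p
    rw [L2.inner_def]
    refine integral_congr_ae ?_
    filter_upwards [coeFn_kick hbar p ψ] with x h1
    rw [h1, ← smul_eq_mul, inner_smul_right]
  simp_rw [h]
  have hi : Integrable (fun x => inner ℂ (φ x) (ψ x)) volume := L2.integrable_inner φ ψ
  refine continuous_of_dominated (bound := fun x => ‖inner ℂ (φ x) (ψ x)‖) ?_ ?_ hi.norm ?_
  · intro p
    exact (continuous_phase_right hbar p).aestronglyMeasurable.mul hi.aestronglyMeasurable
  · intro p
    filter_upwards with x
    rw [norm_mul, norm_phase, one_mul]
  · filter_upwards with x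
    exact (continuous_phase_left hbar x).mul continuous_const

theorem continuous_kick_apply (hbar : ℝ) (ψ : WaveSpace) :
    Continuous fun p => kick hbar p ψ := by
  refine continuous_iff_continuousAt.2 fun q => ?_
  rw [ContinuousAt, tendsto_iff_norm_sub_tendsto_zero]
  have hsq : ∀ p, ‖kick hbar p ψ - kick hbar q ψ‖ ^ 2
      = 2 * ‖ψ‖ ^ 2 - 2 * RCLike.re (inner ℂ (kick hbar q ψ) (kick hbar p ψ)) := by
    intro p
    rw [norm_sub_sq (𝕜 := ℂ), norm_kick_apply, norm_kick_apply, inner_re_symm]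
    ring
  have hq : RCLike.re (inner ℂ (kick hbar q ψ) (kick hbar q ψ)) = ‖ψ‖ ^ 2 := by
    rw [inner_self_eq_norm_sq, norm_kick_apply]
  have h1 : Tendsto (fun p => ‖kick hbar p ψ - kick hbar q ψ‖ ^ 2) (𝓝 q) (𝓝 0) := by
    simp_rw [hsq]
    have h2 : Continuous fun p =>
        2 * ‖ψ‖ ^ 2 - 2 * RCLike.re (inner ℂ (kick hbar q ψ) (kick hbar p ψ)) :=
      continuous_const.sub
        (continuous_const.mul (RCLike.continuous_re.comp (continuous_inner_kick hbar _ ψ)))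
    have h3 := h2.tendsto q
    rw [hq] at h3
    simpa using h3
  have h4 := h1.sqrt
  simpa [Real.sqrt_sq] using h4

theorem continuous_kicked (hbar : ℝ) (ρ : WaveSpace →L[ℂ] WaveSpace) (ψ : WaveSpace) :
    Continuous fun p => kick hbar p (ρ (kick hbar (-p) ψ)) := by
  have hv : Continuous fun p => ρ (kick hbar (-p) ψ) :=
    ρ.continuous.comp ((continuous_kick_apply hbar ψ).comp continuous_neg)
  refine continuous_iff_continuousAt.2 fun q => ?_
  rw [ContinuousAt, tendsto_iff_norm_sub_tendsto_zero]
  have h1 : Tendsto (fun p => ‖ρ (kick hbar (-p) ψ) - ρ (kick hbar (-q) ψ)‖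
      + ‖kick hbar p (ρ (kick hbar (-q) ψ)) - kick hbar q (ρ (kick hbar (-q) ψ))‖)
      (𝓝 q) (𝓝 (0 + 0)) :=
    (tendsto_iff_norm_sub_tendsto_zero.1 (hv.tendsto q)).add
      (tendsto_iff_norm_sub_tendsto_zero.1
        ((continuous_kick_apply hbar (ρ (kick hbar (-q) ψ))).tendsto q))
  rw [add_zero] at h1
  refine squeeze_zero (fun _ => norm_nonneg _) (fun p => ?_) h1
  rw [← norm_kick_apply hbar p (ρ (kick hbar (-p) ψ) - ρ (kick hbar (-q) ψ)), map_sub]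
  exact norm_sub_le_norm_sub_add_norm_sub _ _ _

theorem norm_kicked_le (hbar : ℝ) (ρ : WaveSpace →L[ℂ] WaveSpace) (ψ : WaveSpace) (p : ℝ) :
    ‖kick hbar p (ρ (kick hbar (-p) ψ))‖ ≤ ‖ρ‖ * ‖ψ‖ := by
  rw [norm_kick_apply]
  refine (ρ.le_opNorm _).trans ?_
  rw [norm_kick_apply]

theorem integrable_kicked (hbar : ℝ) (μ : Measure ℝ) [IsProbabilityMeasure μ]
    (ρ : WaveSpace →L[ℂ] WaveSpace) (ψ : WaveSpace) :
    Integrable (fun p => kick hbar p (ρ (kick hbar (-p) ψ))) μ :=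
  Integrable.of_bound (continuous_kicked hbar ρ ψ).aestronglyMeasurable (‖ρ‖ * ‖ψ‖)
    (Eventually.of_forall fun p => norm_kicked_le hbar ρ ψ p)

/-- The random-momentum-kick dephasing channel
`Δ_g(ρ) = ∫ e^{(i/ħ) p X} ρ e^{-(i/ħ) p X} dμ(p)`,
the integral being taken in the strong operator topology. Here `μ` is the probability law of the
momentum kick (`dμ(p) = g̃(p) dp` if it has a density `g̃`). -/
def dephasing (hbar : ℝ) (μ : Measure ℝ) [IsProbabilityMeasure μ]
    (ρ : WaveSpace →L[ℂ] WaveSpace) : WaveSpace →L[ℂ] WaveSpace :=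
  LinearMap.mkContinuous
    { toFun := fun ψ => ∫ p, kick hbar p (ρ (kick hbar (-p) ψ)) ∂μ
      map_add' := fun φ ψ => by
        simp only [map_add]
        exact integral_add (integrable_kicked hbar μ ρ φ) (integrable_kicked hbar μ ρ ψ)
      map_smul' := fun c ψ => by
        simp only [map_smul, RingHom.id_apply]
        exact integral_smul c _ }
    ‖ρ‖ (fun ψ => by
      have h := norm_integral_le_of_norm_le_const (μ := μ)
        (Eventually.of_forall fun p => norm_kicked_le hbar ρ ψ p)
      simpa using h)

/-- The dephasing function `g(ξ) = ∫ e^{(i/ħ) p ξ} dμ(p)`, the characteristic function of the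
law of the momentum kick. -/
def dephasingFunction (hbar : ℝ) (μ : Measure ℝ) (ξ : ℝ) : ℂ :=
  ∫ p, phase hbar p ξ ∂μ

/-- `k` is the square-integrable position kernel of the operator `T`:
`⟨φ, T ψ⟩ = ∬ conj (φ x) k(x, y) ψ(y) dx dy`. -/
def HasPositionKernel (T : WaveSpace →L[ℂ] WaveSpace) (k : ℝ × ℝ → ℂ) : Prop :=
  MemLp k 2 volume ∧
    ∀ φ ψ : WaveSpace, inner ℂ φ (T ψ) = ∫ z : ℝ × ℝ, conj (φ z.1) * k z * ψ z.2

/-- `T` is a trace-class operator on the Hilbert space `H`: `Tr |T| < ∞`, where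
`|T| = (T* T)^{1/2}`. -/
def IsTraceClass {H : Type} [NormedAddCommGroup H] [InnerProductSpace ℂ H] [CompleteSpace H]
    (T : H →L[ℂ] H) : Prop :=
  ∀ (ι : Type) (b : HilbertBasis ι ℂ H),
    Summable fun i => RCLike.re (inner ℂ (b i) (CFC.abs T (b i)))

/-- A (normal) density operator: a positive trace-class operator with trace `1`. -/
structure IsDensityOperator {H : Type} [NormedAddCommGroup H] [InnerProductSpace ℂ H]
    [CompleteSpace H] (ρ : H →L[ℂ] H) : Prop where
  isPositive : ρ.IsPositive
  isTraceClass : IsTraceClass ρ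
  trace_eq_one : ∀ (ι : Type) (b : HilbertBasis ι ℂ H),
    HasSum (fun i => inner ℂ (b i) (ρ (b i))) 1

theorem inner_dephasing (hbar : ℝ) (μ : Measure ℝ) [IsProbabilityMeasure μ]
    (ρ : WaveSpace →L[ℂ] WaveSpace) (φ ψ : WaveSpace) :
    inner ℂ φ (dephasing hbar μ ρ ψ)
      = ∫ p, inner ℂ φ (kick hbar p (ρ (kick hbar (-p) ψ))) ∂μ :=
  (integral_inner (integrable_kicked hbar μ ρ ψ) φ).symm

theorem inner_kick (hbar p : ℝ) (φ ψ : WaveSpace) :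
    inner ℂ φ (kick hbar p ψ) = inner ℂ (kick hbar (-p) φ) ψ := by
  rw [L2.inner_def, L2.inner_def]
  refine integral_congr_ae ?_
  filter_upwards [coeFn_kick hbar p ψ, coeFn_kick hbar (-p) φ] with x h1 h2
  rw [h1, h2]
  have h3 : conj (phase hbar (-p) x) = phase hbar p x := by
    unfold phase
    rw [← Complex.exp_conj]
    congr 1
    simp only [map_mul, Complex.conj_I, Complex.conj_ofReal]
    push_cast
    ring
  simp only [RCLike.inner_apply, map_mul, h3]
  ring

/-- In the position representation the dephasing channel acts by
`ρ(x, y) ↦ g(x - y) ρ(x, y)`. -/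
theorem HasPositionKernel.dephasing {ρ : WaveSpace →L[ℂ] WaveSpace} {k : ℝ × ℝ → ℂ}
    (hk : HasPositionKernel ρ k) (hbar : ℝ) (μ : Measure ℝ) [IsProbabilityMeasure μ] :
    HasPositionKernel (dephasing hbar μ ρ)
      (fun z => dephasingFunction hbar μ (z.1 - z.2) * k z) := by
  have hcont : Continuous (dephasingFunction hbar μ) := by
    refine continuous_of_dominated (bound := fun _ => 1) ?_ ?_ (integrable_const _) ?_
    · intro ξ
      exact (continuous_phase_left hbar ξ).aestronglyMeasurable
    · intro ξ
      exact Eventually.of_forall fun p => (norm_phase hbar p ξ).le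
    · exact Eventually.of_forall fun p => continuous_phase_right hbar p
  have hbd : ∀ ξ, ‖dephasingFunction hbar μ ξ‖ ≤ 1 := by
    intro ξ
    have h := norm_integral_le_of_norm_le_const (μ := μ)
      (Eventually.of_forall fun p => (norm_phase hbar p ξ).le)
    simpa [dephasingFunction] using h
  refine ⟨hk.1.of_le (((hcont.comp (continuous_fst.sub continuous_snd)).aestronglyMeasurable).mul
    hk.1.aestronglyMeasurable) (Eventually.of_forall fun z => ?_), fun φ ψ => ?_⟩
  · rw [norm_mul]
    exact mul_le_of_le_one_left (norm_nonneg _) (hbd _)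
  have hint : Integrable (fun z : ℝ × ℝ => conj (φ z.1) * k z * ψ z.2) volume := by
    have h1 : MemLp (fun z : ℝ × ℝ => conj (φ z.1) * ψ z.2) 2 volume := by
      have hφ : MemLp (fun x => conj (φ x)) 2 volume := (Lp.memLp φ).star
      rw [memLp_two_iff_integrable_sq_norm]
      · have h2 := (hφ.integrable_norm_pow (by norm_num)).mul_prod
          ((Lp.memLp ψ).integrable_norm_pow (by norm_num))
        refine h2.congr (Eventually.of_forall fun z => ?_)
        simp [mul_pow]
      · exact hφ.aestronglyMeasurable.comp_fst.mul (Lp.aestronglyMeasurable ψ).comp_snd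
    have h3 := h1.integrable_mul hk.1
    refine h3.congr (Eventually.of_forall fun z => ?_)
    simp only [Pi.mul_apply]
    ring
  have hkicked : ∀ p, inner ℂ φ (kick hbar p (ρ (kick hbar (-p) ψ)))
      = ∫ z : ℝ × ℝ, phase hbar p (z.1 - z.2) * (conj (φ z.1) * k z * ψ z.2) := by
    intro p
    rw [inner_kick, hk.2]
    refine integral_congr_ae ?_
    have e1 := Measure.quasiMeasurePreserving_fst (μ := (volume : Measure ℝ))
      (ν := (volume : Measure ℝ)) |>.ae (coeFn_kick hbar (-p) φ)
    have e2 := Measure.quasiMeasurePreserving_snd (μ := (volume : Measure ℝ))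
      (ν := (volume : Measure ℝ)) |>.ae (coeFn_kick hbar (-p) ψ)
    filter_upwards [e1, e2] with z h1 h2
    rw [h1, h2]
    have h3 : phase hbar p (z.1 - z.2)
        = conj (phase hbar (-p) z.1) * phase hbar (-p) z.2 := by
      unfold phase
      rw [← Complex.exp_conj, ← Complex.exp_add]
      congr 1
      simp only [map_mul, Complex.conj_I, Complex.conj_ofReal]
      push_cast
      ring
    rw [h3, map_mul]
    ring
  rw [inner_dephasing]
  simp_rw [hkicked]
  rw [integral_integral_swap]
  · refine integral_congr_ae (Eventually.of_forall fun z => ?_)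
    simp only [integral_mul_const, dephasingFunction]
    ring
  · have h4 : Integrable (fun w : ℝ × (ℝ × ℝ) => (conj (φ w.2.1) * k w.2 * ψ w.2.2))
        (μ.prod volume) := hint.comp_snd μ
    refine h4.mono (AEStronglyMeasurable.mul ?_ h4.aestronglyMeasurable)
      (Eventually.of_forall fun w => ?_)
    · exact ((continuous_phase hbar).comp (continuous_fst.prodMk
        (continuous_snd.fst.sub continuous_snd.snd))).aestronglyMeasurable
    · simp [Function.uncurry, norm_phase]

/-- The fixed-point incoherent set of the dephasing channel. Its elements are positive bounded
operators that need not be normalizable (the identity is one of them), so that being a normal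
state is a separate condition, `IsDensityOperator`. -/
def fixedPointIncoherent (hbar : ℝ) (μ : Measure ℝ) [IsProbabilityMeasure μ] :
    Set (WaveSpace →L[ℂ] WaveSpace) :=
  {ρ | ρ.IsPositive ∧ dephasing hbar μ ρ = ρ}

end PositionDephasing

end

open MeasureTheory Filter Topology

/-! A positive operator of finite trace is compact, so if it is nonzero, `‖ρ‖` is an eigenvalue
whose eigenspace `E` is finite-dimensional. If `ρ` is fixed and `v ∈ E`, then `‖ρ‖ ‖v‖²` is the
`μ`-average of the quadratic form of `ρ` at the kicked vectors `kick hbar (-p) v`. None of these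
values can have real part above `‖ρ‖ ‖v‖²`, so almost all attain it, and almost every kick sends `v`
into `E` (`ae_kick_mem_eigenspace`). As `μ` is not the point mass at `0`, some nontrivial kick
preserves `E`, hence has an eigenvector there. Multiplication by a nonconstant phase has none
(`eq_zero_of_kick_eq_smul`). -/

namespace PositionDephasing

/-! ### Compactness and the top eigenvalue of positive operators. -/

section HilbertSpace

variable {H : Type} [NormedAddCommGroup H] [InnerProductSpace ℂ H]

/-- Cauchy–Schwarz and Bessel; this controls the tails of the finite-rank expansion of a
Hilbert–Schmidt operator. -/
theorem norm_sum_inner_smulRight_sq_le {ι : Type} (b : HilbertBasis ι ℂ H) (T : H →L[ℂ] H)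
    (s : Finset ι) :
    ‖∑ i ∈ s, (innerSL ℂ (b i)).smulRight (T (b i))‖ ^ 2 ≤ ∑ i ∈ s, ‖T (b i)‖ ^ 2 := by
  have hC : 0 ≤ ∑ i ∈ s, ‖T (b i)‖ ^ 2 := Finset.sum_nonneg fun i _ => sq_nonneg _
  have key : ‖∑ i ∈ s, (innerSL ℂ (b i)).smulRight (T (b i))‖
      ≤ √(∑ i ∈ s, ‖T (b i)‖ ^ 2) := by
    refine ContinuousLinearMap.opNorm_le_bound _ (Real.sqrt_nonneg _) fun v => ?_
    rw [sum_apply]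
    calc ‖∑ i ∈ s, ((innerSL ℂ (b i)).smulRight (T (b i))) v‖
        ≤ ∑ i ∈ s, ‖T (b i)‖ * ‖inner ℂ (b i) v‖ := by
          refine (norm_sum_le _ _).trans (Finset.sum_le_sum fun i _ => ?_)
          rw [ContinuousLinearMap.smulRight_apply, norm_smul, innerSL_apply_apply, mul_comm]
      _ ≤ √(∑ i ∈ s, ‖T (b i)‖ ^ 2) * √(∑ i ∈ s, ‖inner ℂ (b i) v‖ ^ 2) :=
          Real.sum_mul_le_sqrt_mul_sqrt _ _ _
      _ ≤ √(∑ i ∈ s, ‖T (b i)‖ ^ 2) * ‖v‖ := by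
          gcongr
          exact Real.sqrt_le_iff.2 ⟨norm_nonneg v, b.orthonormal.sum_inner_products_le v⟩
  calc _ ≤ √(∑ i ∈ s, ‖T (b i)‖ ^ 2) ^ 2 := by gcongr
    _ = _ := Real.sq_sqrt hC

/-- Hilbert–Schmidt operators are compact. -/
theorem isCompactOperator_of_summable_norm_sq [CompleteSpace H] {ι : Type}
    (b : HilbertBasis ι ℂ H) (T : H →L[ℂ] H) (hT : Summable fun i => ‖T (b i)‖ ^ 2) :
    IsCompactOperator T := by
  -- The rank-one terms need not be absolutely summable, so the Cauchy criterion is applied to whole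
  -- finite blocks.
  have hsum : Summable fun i => (innerSL ℂ (b i)).smulRight (T (b i)) := by
    rw [summable_iff_vanishing_norm]
    intro ε hε
    obtain ⟨s, hs⟩ := summable_iff_vanishing_norm.1 hT (ε ^ 2) (by positivity)
    refine ⟨s, fun t ht => ?_⟩
    have h := norm_sum_inner_smulRight_sq_le b T t
    exact lt_of_pow_lt_pow_left₀ 2 hε.le
      (h.trans_lt ((le_abs_self _).trans_lt (hs t ht)))
  obtain ⟨L, hL⟩ := hsum
  have hLT : L = T := by
    ext v
    have h1 : HasSum (fun i => (innerSL ℂ (b i)).smulRight (T (b i)) v) (L v) :=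
      hL.mapL (ContinuousLinearMap.apply ℂ H v)
    have h2 : HasSum (fun i => T (b.repr v i • b i)) (T v) := (b.hasSum_repr v).mapL T
    refine h1.unique (h2.congr_fun fun i => ?_)
    simp [b.repr_apply_apply]
  rw [hLT] at hL
  refine isCompactOperator_of_tendsto hL (Eventually.of_forall fun s => ?_)
  refine Submodule.sum_mem (compactOperator (RingHom.id ℂ) H H) fun i _ => ?_
  have hc : IsCompactOperator (ContinuousLinearMap.toSpanSingleton ℂ (T (b i))) :=
    isCompactOperator_of_locallyCompactSpace_rng _
  exact hc.comp_clm (innerSL ℂ (b i))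

/-- A positive operator with finite trace is compact. -/
theorem isCompactOperator_of_isPositive_of_summable [CompleteSpace H] {ι : Type}
    (b : HilbertBasis ι ℂ H) {T : H →L[ℂ] H} (hT : T.IsPositive)
    (hs : Summable fun i => inner ℂ (b i) (T (b i))) : IsCompactOperator T := by
  have hT0 : 0 ≤ T := (ContinuousLinearMap.nonneg_iff_isPositive T).2 hT
  have hmul : CFC.sqrt T * CFC.sqrt T = T := CFC.sqrt_mul_sqrt_self T hT0
  have hpos : (CFC.sqrt T).IsPositive :=
    (ContinuousLinearMap.nonneg_iff_isPositive _).1 (CFC.sqrt_nonneg T)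
  have hinner : ∀ v, RCLike.re (inner ℂ v (T v)) = ‖CFC.sqrt T v‖ ^ 2 := by
    intro v
    rw [← inner_self_eq_norm_sq (𝕜 := ℂ), hpos.inner_left_eq_inner_right,
      ← mul_apply_eq_comp, hmul]
  -- By `hinner`, the diagonal entries of `T` are the squared norms `‖√T (b i)‖²`, so `√T` is
  -- Hilbert–Schmidt.
  have hS : IsCompactOperator (CFC.sqrt T : H →L[ℂ] H) := by
    refine isCompactOperator_of_summable_norm_sq b (CFC.sqrt T) ?_
    simp_rw [← hinner]
    exact hs.mapL Complex.reCLM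
  have h := hS.comp_clm (CFC.sqrt T)
  change IsCompactOperator ⇑(CFC.sqrt T * CFC.sqrt T : H →L[ℂ] H) at h
  rwa [hmul] at h

/-- The norm of a nonzero positive compact operator is an eigenvalue. -/
theorem hasEigenvalue_norm_of_isPositive [CompleteSpace H] {T : H →L[ℂ] H} (hT : T.IsPositive)
    (hc : IsCompactOperator T) (h0 : T ≠ 0) :
    Module.End.HasEigenvalue (T : Module.End ℂ H) (‖T‖ : ℂ) := by
  have : Nontrivial (H →L[ℂ] H) := ⟨T, 0, h0⟩
  have hT0 : 0 ≤ T := (ContinuousLinearMap.nonneg_iff_isPositive T).2 hT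
  have hmem : ‖T‖ ∈ spectrum ℝ T := CStarAlgebra.norm_mem_spectrum_of_nonneg hT0
  have hmem' : (‖T‖ : ℂ) ∈ spectrum ℂ T := spectrum.algebraMap_mem ℂ hmem
  exact (hc.hasEigenvalue_iff_mem_spectrum (by simpa using h0)).2 hmem'

/-- A vector on which the quadratic form of `T` attains the norm of `T` is an eigenvector. -/
theorem apply_eq_norm_smul_of_le_re_inner (T : H →L[ℂ] H) (v : H)
    (h : ‖T‖ * ‖v‖ ^ 2 ≤ RCLike.re (inner ℂ v (T v))) : T v = (‖T‖ : ℂ) • v := by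
  rw [← sub_eq_zero, ← norm_eq_zero, ← sq_eq_zero_iff]
  refine le_antisymm ?_ (sq_nonneg _)
  -- The expansion is `‖Tv‖² - 2‖T‖ Re⟨v, Tv⟩ + ‖T‖²‖v‖²`, at most `0` by `h1` and `h2`.
  rw [norm_sub_sq (𝕜 := ℂ), inner_smul_right, ← inner_conj_symm, norm_smul]
  have h1 : ‖T v‖ ^ 2 ≤ (‖T‖ * ‖v‖) ^ 2 := by gcongr; exact T.le_opNorm v
  have h2 : ‖T‖ * (‖T‖ * ‖v‖ ^ 2) ≤ ‖T‖ * RCLike.re (inner ℂ v (T v)) := by gcongr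
  simp only [RCLike.re_to_complex, Complex.re_ofReal_mul, Complex.conj_re, Complex.norm_real,
    norm_norm] at h2 ⊢
  nlinarith

end HilbertSpace

/-! ### Momentum kicks and the top eigenspace of a fixed point. -/

/-- If `v` attains the norm of a fixed point, then so do almost all kicked copies of `v`. -/
theorem ae_kick_mem_eigenspace {hbar : ℝ} {μ : Measure ℝ} [IsProbabilityMeasure μ]
    {ρ : WaveSpace →L[ℂ] WaveSpace} (hfix : dephasing hbar μ ρ = ρ) {v : WaveSpace}
    (hv : ρ v = (‖ρ‖ : ℂ) • v) :
    ∀ᵐ p ∂μ, ρ (kick hbar (-p) v) = (‖ρ‖ : ℂ) • kick hbar (-p) v := by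
  set f : ℝ → ℝ := fun p => RCLike.re (inner ℂ v (kick hbar p (ρ (kick hbar (-p) v)))) with hf
  have hint : Integrable (fun p => inner ℂ v (kick hbar p (ρ (kick hbar (-p) v)))) μ :=
    (integrable_kicked hbar μ ρ v).const_inner v
  have hfi : Integrable f μ := hint.re
  have hfv : ∫ p, f p ∂μ = ‖ρ‖ * ‖v‖ ^ 2 := by
    rw [hf, integral_re hint, ← inner_dephasing, hfix, hv, inner_smul_right,
      inner_self_eq_norm_sq_to_K]
    norm_cast
    exact Complex.re_ofReal_mul _ _ |>.trans (congrArg _ (Complex.ofReal_re _))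
  have hle : ∀ p, 0 ≤ ‖ρ‖ * ‖v‖ ^ 2 - f p := by
    intro p
    have h := (RCLike.re_le_norm _).trans
      ((norm_inner_le_norm (𝕜 := ℂ) v (kick hbar p (ρ (kick hbar (-p) v)))).trans
        (mul_le_mul_of_nonneg_left (norm_kicked_le hbar ρ v p) (norm_nonneg v)))
    simp only [hf]
    linarith
  -- A nonnegative integrand with zero integral vanishes almost everywhere.
  have hzero : ∫ p, (‖ρ‖ * ‖v‖ ^ 2 - f p) ∂μ = 0 := by
    rw [integral_sub (integrable_const _) hfi, hfv]
    simp
  rw [integral_eq_zero_iff_of_nonneg hle ((integrable_const _).sub hfi)] at hzero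
  filter_upwards [hzero] with p hp
  refine apply_eq_norm_smul_of_le_re_inner ρ _ ?_
  rw [norm_kick_apply, ← inner_kick]
  simp only [Pi.zero_apply, hf] at hp
  linarith

/-- The phase is periodic in `x` with period `2πħ/p`, so a level set is empty or one coset of the
period lattice. Level sets are thus Lebesgue-null, which excludes eigenvectors of the kick. -/
theorem countable_setOf_phase_eq {hbar p : ℝ} (hh : hbar ≠ 0) (hp : p ≠ 0) (c : ℂ) :
    {x : ℝ | phase hbar p x = c}.Countable := by
  rcases Set.eq_empty_or_nonempty {x : ℝ | phase hbar p x = c} with h | ⟨y, hy⟩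
  · rw [h]; exact Set.countable_empty
  refine (Set.countable_range fun n : ℤ => y + n * (2 * Real.pi) * hbar / p).mono fun x hx => ?_
  have h : phase hbar p x = phase hbar p y := Eq.trans hx (Eq.symm hy)
  obtain ⟨n, hn⟩ := Complex.exp_eq_exp_iff_exists_int.1 h
  have hn' : p * x / hbar = p * y / hbar + n * (2 * Real.pi) := by
    have h1 := congrArg Complex.im hn
    simpa using h1
  refine ⟨n, ?_⟩
  field_simp at hn' ⊢
  linarith

/-- A nontrivial kick has no eigenvectors. -/
theorem eq_zero_of_kick_eq_smul {hbar p : ℝ} (hh : hbar ≠ 0) (hp : p ≠ 0) {c : ℂ} {v : WaveSpace}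
    (h : kick hbar p v = c • v) : v = 0 := by
  rw [Lp.eq_zero_iff_ae_eq_zero]
  have hae : ∀ᵐ x ∂(volume : Measure ℝ), phase hbar p x ≠ c :=
    (countable_setOf_phase_eq hh hp c).ae_notMem volume
  have h1 := coeFn_kick hbar p v
  rw [h] at h1
  filter_upwards [h1, Lp.coeFn_smul c v, hae] with x hx1 hx2 hx3
  rw [hx2, Pi.smul_apply, smul_eq_mul] at hx1
  by_contra hx
  exact hx3 (mul_right_cancel₀ hx hx1).symm

/-- If `p = 0` almost surely, the characteristic function is identically `1`. -/
theorem exists_ne_zero_of_norm_dephasingFunction_lt_one {hbar ξ : ℝ} {μ : Measure ℝ}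
    [IsProbabilityMeasure μ] (hg : ‖dephasingFunction hbar μ ξ‖ < 1) : ∃ᵐ p ∂μ, p ≠ 0 := by
  intro h
  have h1 : dephasingFunction hbar μ ξ = 1 := by
    rw [dephasingFunction, integral_congr_ae (g := fun _ => (1 : ℂ))]
    · simp
    · filter_upwards [h] with p hp
      rw [not_not] at hp
      simp [phase, hp]
  simp [h1] at hg

end PositionDephasing

theorem proposition1 (hbar : ℝ) (hhbar : 0 < hbar)
    (μ : MeasureTheory.Measure ℝ) [MeasureTheory.IsProbabilityMeasure μ]
    (hg : ∀ ξ : ℝ, ξ ≠ 0 → ‖PositionDephasing.dephasingFunction hbar μ ξ‖ < 1) :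
    ∀ ρ ∈ PositionDephasing.fixedPointIncoherent hbar μ,
      ¬ PositionDephasing.IsDensityOperator ρ := by
  open PositionDephasing in
  rintro ρ ⟨hpos, hfix⟩ hρ
  obtain ⟨w, b, -⟩ := exists_hilbertBasis ℂ WaveSpace
  have htr := hρ.trace_eq_one w b
  have hρ0 : ρ ≠ 0 := by
    rintro rfl
    simp only [zero_apply, inner_zero_right] at htr
    exact zero_ne_one (hasSum_zero.unique htr)
  have hc := isCompactOperator_of_isPositive_of_summable b hpos htr.summable
  have hev := hasEigenvalue_norm_of_isPositive hpos hc hρ0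
  set E := Module.End.eigenspace (ρ : Module.End ℂ WaveSpace) (‖ρ‖ : ℂ) with hE
  have hmem : ∀ v, v ∈ E ↔ ρ v = (‖ρ‖ : ℂ) • v := fun v => Module.End.mem_eigenspace_iff
  have : FiniteDimensional ℂ E :=
    ContinuousLinearMap.finite_dimensional_eigenspace hc _ (by simpa using hρ0)
  have : Nontrivial E := Submodule.nontrivial_iff_ne_bot.2 hev
  let e := Module.finBasis ℂ E
  -- The exceptional null set depends on the vector; a finite basis gives one null set valid for all
  -- of `E`.
  have hae : ∀ᵐ p ∂μ, ∀ i, kick hbar (-p) (e i) ∈ E := by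
    rw [ae_all_iff]
    intro i
    filter_upwards [ae_kick_mem_eigenspace hfix ((hmem _).1 (e i).2)] with p hp
    exact (hmem _).2 hp
  obtain ⟨p, hp0, hp⟩ :=
    ((exists_ne_zero_of_norm_dephasingFunction_lt_one (hg 1 one_ne_zero)).and_eventually hae).exists
  have hinv : ∀ v ∈ E, (kick hbar (-p) : Module.End ℂ WaveSpace) v ∈ E := by
    intro v hv
    have h1 := e.sum_repr ⟨v, hv⟩
    have h2 : v = ∑ i, e.repr ⟨v, hv⟩ i • (e i : WaveSpace) := by
      have h3 := congrArg E.subtype h1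
      rw [map_sum] at h3
      exact h3.symm
    rw [h2, map_sum]
    refine E.sum_mem fun i _ => ?_
    rw [map_smul]
    exact E.smul_mem _ (hp i)
  -- `E` is nonzero and finite-dimensional over `ℂ`, so the restricted kick has an eigenvector.
  obtain ⟨c, hcv⟩ := Module.End.exists_eigenvalue
    ((kick hbar (-p) : Module.End ℂ WaveSpace).restrict hinv)
  obtain ⟨v, hv⟩ := hcv.exists_hasEigenvector
  refine hv.2 (Subtype.ext ?_)
  refine eq_zero_of_kick_eq_smul hhbar.ne' (neg_ne_zero.2 hp0) (c := c) ?_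
  exact congrArg Subtype.val hv.apply_eq_smul
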